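/- Let $G$ be a (discrete) group and let $F\le H\le G$ be subgroups such that for every finite set $S\subseteq G\setminus H$ there is $f\in F$ with $gfh\notin F$ for all $g,h\in S$. Let $\lambda$ be the left regular representation of $G$ on $\ell^2(G)$; for a subgroup $K\le G$ let $L(K)=\{\lambda_k : k\in K\}''\subseteq B(\ell^2(G))$, let $\tau(x)=\langle x\delta_e,\delta_e\rangle$ be the canonical faithful normal tracial state on $L(G)$, put $\|x\|_2=\tau(x^*x)^{1/2}$, and let $E_{L(K)}$ be the $\tau$-preserving conditional expectation of $L(G)$ onto $L(K)$. Then the triple $L(F)\subseteq L(H)\subseteq L(G)$ has the relative weak asymptotic homomorphism property: for all $x_1,\dots,x_n\in L(G)$ and every $\varepsilon>0$ there is a unitary $u\in L(F)$ such that $$\bigl\|E_{L(F)}(x_iux_j)-E_{L(F)}\bigl(E_{L(H)}(x_i)\,u\,E_{L(H)}(x_j)\bigr)\bigr\|_2<\varepsilon\qquad\text{for all } i,j=1,\dots,n.$$ If moreover $F$ is normal in $H$, then $\mathcal N_{L(G)}(L(F))''=L(H)$, where $\mathcal N_{L(G)}(L(F))$ is the group of unitaries $u\in L(G)$ with $uL(F)u^*=L(F)$,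 and $''$ denotes the double commutant. -/

import Mathlib

noncomputable section

namespace GroupWAHP

section General

variable {K : Type*} [NormedAddCommGroup K] [InnerProductSpace ℂ K] [CompleteSpace K]

/-- The von Neumann algebra on `K` generated by a set `S` of bounded operators, i.e. the double
commutant of `S ∪ S*`. -/
def generated (S : Set (K →L[ℂ] K)) : VonNeumannAlgebra K where
  toStarSubalgebra := StarSubalgebra.centralizer ℂ (StarSubalgebra.centralizer ℂ S : Set (K →L[ℂ] K))
  centralizer_centralizer' := by
    simp

/-- `τ` is a faithful normal tracial state on `M`; normality is expressed as ultraweak continuity. -/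
structure IsFaithfulNormalTrace {M : VonNeumannAlgebra K}
    (τ : M.toStarSubalgebra →ₗ[ℂ] ℂ) : Prop where
  map_one : τ 1 = 1
  nonneg : ∀ x, 0 ≤ (τ (star x * x)).re ∧ (τ (star x * x)).im = 0
  tracial : ∀ x y, τ (x * y) = τ (y * x)
  faithful : ∀ x, τ (star x * x) = 0 → x = 0
  normal : ∃ ξ η : ℕ → K, (Summable fun n => ‖ξ n‖ ^ 2) ∧ (Summable fun n => ‖η n‖ ^ 2) ∧
    ∀ x : M.toStarSubalgebra, HasSum (fun n => inner ℂ (ξ n) ((x : K →L[ℂ] K) (η n))) (τ x)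

/-- The 2-norm `‖x‖₂ = τ(x* x)^(1/2)` on `M` attached to the trace `τ`. -/
def twoNorm {M : VonNeumannAlgebra K} (τ : M.toStarSubalgebra →ₗ[ℂ] ℂ)
    (x : M.toStarSubalgebra) : ℝ :=
  Real.sqrt (τ (star x * x)).re

/-- `E` is the `τ`-preserving conditional expectation of `M` onto its von Neumann subalgebra `B`:
a positive linear `B`-bimodule projection of `M` onto `B` that preserves `τ`. (For a faithful trace
`τ` there is only one such map.) -/
structure IsCondExp {M : VonNeumannAlgebra K} (τ : M.toStarSubalgebra →ₗ[ℂ] ℂ)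
    (B : VonNeumannAlgebra K) (E : M.toStarSubalgebra →ₗ[ℂ] M.toStarSubalgebra) : Prop where
  mem : ∀ x, (E x : K →L[ℂ] K) ∈ B
  apply_of_mem : ∀ x : M.toStarSubalgebra, (x : K →L[ℂ] K) ∈ B → E x = x
  positive : ∀ x : M.toStarSubalgebra,
    (x : K →L[ℂ] K).IsPositive → (E x : K →L[ℂ] K).IsPositive
  bimodule : ∀ a x b : M.toStarSubalgebra, (a : K →L[ℂ] K) ∈ B → (b : K →L[ℂ] K) ∈ B →
    E (a * x * b) = a * E x * b
  trace_preserving : ∀ x, τ (E x) = τ x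

/-- The relative weak asymptotic homomorphism property of a triple `B ⊆ N ⊆ M` of von Neumann
algebras, with respect to the faithful normal tracial state `τ` of `M`. The trace-preserving conditional expectations
`EB`, `EN` are required to exist. -/
def RelativeWAHP (B N M : VonNeumannAlgebra K) (τ : M.toStarSubalgebra →ₗ[ℂ] ℂ) : Prop :=
  B ≤ N ∧ N ≤ M ∧ IsFaithfulNormalTrace τ ∧
    ∃ EB EN : M.toStarSubalgebra →ₗ[ℂ] M.toStarSubalgebra,
      IsCondExp τ B EB ∧ IsCondExp τ N EN ∧
      ∀ (n : ℕ) (x : Fin n → M.toStarSubalgebra) (ε : ℝ), 0 < ε →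
        ∃ u ∈ unitary M.toStarSubalgebra, (u : K →L[ℂ] K) ∈ B ∧
          ∀ i j, twoNorm τ (EB (x i * u * x j) - EB (EN (x i) * u * EN (x j))) < ε

/-- The normalizer `𝒩_M(B)`: the unitaries `u` of `M` with `u B u* = B`. -/
def normalizer (M B : VonNeumannAlgebra K) : Set (K →L[ℂ] K) :=
  {u | u ∈ M ∧ u ∈ unitary (K →L[ℂ] K) ∧ (fun b => u * b * star u) '' (B : Set (K →L[ℂ] K)) = B}

end General

section Group

variable {G : Type*} [Group G]

/-- The Hilbert space `ℓ²(G)`. -/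
abbrev L2 (G : Type*) : Type _ := lp (fun _ : G => ℂ) 2

theorem memℓp_translate (g : G) (ξ : L2 G) : Memℓp (fun x => ξ (g⁻¹ * x)) 2 := by
  have h := (memℓp_gen_iff (p := 2) (by norm_num)).1 (lp.memℓp ξ)
  exact (memℓp_gen_iff (p := 2) (by norm_num)).2 (h.comp_injective (mul_right_injective g⁻¹))

/-- The left regular representation: `(lam g ξ) x = ξ (g⁻¹ x)` on `ℓ²(G)`. -/
def lam (g : G) : L2 G →L[ℂ] L2 G :=
  LinearIsometry.toContinuousLinearMap
    { toFun := fun ξ => ⟨fun x => ξ (g⁻¹ * x), memℓp_translate g ξ⟩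
      map_add' := fun _ _ => rfl
      map_smul' := fun _ _ => rfl
      norm_map' := fun ξ => by
        rw [lp.norm_eq_tsum_rpow (by norm_num), lp.norm_eq_tsum_rpow (by norm_num)]
        congr 1
        exact (Equiv.mulLeft g⁻¹).tsum_eq (fun x => ‖ξ x‖ ^ (2 : ENNReal).toReal) }

/-- The group von Neumann algebra `L(H)` of a subgroup `H` of `G`, as the von Neumann algebra on
`ℓ²(G)` generated by the operators `lam h`, `h ∈ H`; `L(G)` is `vN ⊤`. -/
def vN (H : Subgroup G) : VonNeumannAlgebra (L2 G) :=
  generated (lam '' (H : Set G))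

/-- The basis vector of `ℓ²(G)` at the neutral element. -/
def delta (G : Type*) [Group G] : L2 G :=
  open Classical in lp.single 2 (1 : G) (1 : ℂ)

/-- The canonical trace `τ(x) = ⟨x δ₁, δ₁⟩` of `L(G)` (Mathlib's inner product is linear in its
second argument). -/
def trace (G : Type*) [Group G] : (vN (⊤ : Subgroup G)).toStarSubalgebra →ₗ[ℂ] ℂ where
  toFun x := inner ℂ (delta G) ((x : L2 G →L[ℂ] L2 G) (delta G))
  map_add' x y := by simp
  map_smul' c x := by simp

end Group

end GroupWAHP

end

/-! An element of `L(G)` is determined by its Fourier coefficients, the vector `x δ`; its 2-norm is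
`‖x δ‖`, and for `x ∈ L(G)` membership in `L(K)` means that `x δ` is supported on `K`. The
expectation onto `L(K)` keeps the matrix entries inside right cosets `K g`, so it restricts `x δ` to
`K`.

For `u ∈ L(H)` the cross terms cancel, and the difference to be estimated is `E_F((x - E_H x) u (y -
E_H y))` (`restrict_mul_mul_sub`). Both outer factors have coefficients supported off `H`. Truncate
them to finite supports and take `u = lam f`, with `f` given by the hypothesis for the union of the
supports: the truncated product then has no coefficient in `F`. Traciality controls the error of
truncating the left factor (`exists_norm_restrict_lt`).

For a normalizing unitary `u`, apply this to the pair `u, u*`. Since `u (lam f) u*` lies in `L(F)`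
and has 2-norm 1, the estimate forces `‖E_H u‖₂ = 1`, so `u ∈ L(H)`. Conversely, if `F` is normal in
`H`, every `lam h` with `h ∈ H` normalizes `L(F)`. -/

noncomputable section

namespace GroupWAHP

/-! ### Matrix entries, coordinate projections and block diagonal parts on `ℓ²`. -/

section Index

variable {G ι : Type*}

/-- The standard basis vector of `ℓ²(G)` at `g`. -/
def basisVec (g : G) : L2 G :=
  open Classical in lp.single 2 g (1 : ℂ)

theorem basisVec_self (g : G) : basisVec g g = 1 :=
  open Classical in lp.single_apply_self (E := fun _ => ℂ) 2 g 1

theorem basisVec_of_ne {g h : G} (hne : h ≠ g) : basisVec g h = 0 :=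
  open Classical in lp.single_apply_ne (E := fun _ => ℂ) 2 g 1 hne

theorem inner_basisVec_left (g : G) (ξ : L2 G) : inner ℂ (basisVec g) ξ = ξ g := by
  simp [basisVec, lp.inner_single_left]

theorem norm_basisVec (g : G) : ‖basisVec g‖ = 1 := by
  simp [basisVec, lp.norm_single]

theorem hasSum_basisVec (ξ : L2 G) : HasSum (fun m => ξ m • basisVec m) ξ := by
  classical
  convert lp.hasSum_single (p := 2) (by norm_num) ξ using 2 with m
  rw [← mul_one (ξ m), ← smul_eq_mul (ξ m) (1 : ℂ), lp.single_smul, smul_eq_mul, mul_one]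
  congr 1

theorem hasSum_map_apply (x : L2 G →L[ℂ] L2 G) (ξ : L2 G) (g : G) :
    HasSum (fun m => ξ m * x (basisVec m) g) (x ξ g) := by
  have h := ((innerSL ℂ (basisVec g)).comp x).hasSum (hasSum_basisVec ξ)
  simpa [inner_basisVec_left, Function.comp_def] using h

theorem ext_basisVec {x y : L2 G →L[ℂ] L2 G}
    (h : ∀ m g, x (basisVec m) g = y (basisVec m) g) : x = y := by
  refine ContinuousLinearMap.ext fun ξ => lp.ext (funext fun g => ?_)
  have hx := hasSum_map_apply x ξ g
  simp only [h] at hx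
  exact hx.unique (hasSum_map_apply y ξ g)

theorem star_apply_basisVec (x : L2 G →L[ℂ] L2 G) (m g : G) :
    star x (basisVec m) g = star (x (basisVec g) m) := by
  rw [← inner_basisVec_left g, ContinuousLinearMap.star_eq_adjoint,
    ContinuousLinearMap.adjoint_inner_right, ← inner_conj_symm, inner_basisVec_left]
  rfl

theorem hasSum_norm_sq (ξ : L2 G) : HasSum (fun g => ‖ξ g‖ ^ 2) (‖ξ‖ ^ 2) := by
  simpa using lp.hasSum_norm (p := 2) (by norm_num) ξ

theorem sum_norm_sq_le (ξ : L2 G) (s : Finset G) : ∑ g ∈ s, ‖ξ g‖ ^ 2 ≤ ‖ξ‖ ^ 2 :=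
  sum_le_hasSum s (fun _ _ => by positivity) (hasSum_norm_sq ξ)

theorem exists_finset_norm_sub_lt {A : Set G} {ξ : L2 G} (hξ : ∀ g ∈ A, ξ g = 0) {η : ℝ}
    (hη : 0 < η) :
    ∃ s : Finset G, (∀ g ∈ s, g ∉ A) ∧ ‖ξ - ∑ g ∈ s, ξ g • basisVec g‖ < η := by
  classical
  obtain ⟨s, hs⟩ := ((Metric.tendsto_nhds.1 (hasSum_basisVec ξ)) η hη).exists
  refine ⟨s.filter (· ∉ A), fun g hg => (Finset.mem_filter.1 hg).2, ?_⟩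
  rw [Finset.sum_filter_of_ne (p := (· ∉ A))
    fun g _ hne hg => hne (by rw [hξ g hg, zero_smul])]
  rwa [dist_comm, dist_eq_norm] at hs

/-- The orthogonal projection of `ℓ²(G)` onto `ℓ²(A)`. -/
def restrict (A : Set G) : L2 G →L[ℂ] L2 G :=
  LinearMap.mkContinuous
    { toFun := fun ξ => ⟨A.indicator ξ, (lp.memℓp ξ).mono' fun g =>
        Set.indicator_le_self' (f := fun g => ‖ξ g‖) (fun _ _ => norm_nonneg _) g |>.trans' <| by
          rw [norm_indicator_eq_indicator_norm]⟩
      map_add' := fun ξ η => lp.ext (Set.indicator_add A ξ η)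
      map_smul' := fun c ξ => lp.ext (Set.indicator_const_smul A c ξ) } 1 fun ξ => by
    rw [one_mul]
    refine lp.norm_mono (by norm_num) fun g => ?_
    exact norm_indicator_le_norm_self ξ g

theorem restrict_apply (A : Set G) (ξ : L2 G) (g : G) : restrict A ξ g = A.indicator ξ g := rfl

theorem restrict_of_mem {A : Set G} {g : G} (hg : g ∈ A) (ξ : L2 G) : restrict A ξ g = ξ g :=
  Set.indicator_of_mem hg ξ

theorem restrict_of_notMem {A : Set G} {g : G} (hg : g ∉ A) (ξ : L2 G) : restrict A ξ g = 0 :=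
  Set.indicator_of_notMem hg ξ

theorem norm_restrict_le (A : Set G) (ξ : L2 G) : ‖restrict A ξ‖ ≤ ‖ξ‖ :=
  lp.norm_mono (by norm_num) fun g => norm_indicator_le_norm_self ξ g

theorem restrict_basisVec_of_mem {A : Set G} {g : G} (hg : g ∈ A) :
    restrict A (basisVec g) = basisVec g := by
  refine lp.ext (funext fun h => ?_)
  by_cases hh : h ∈ A
  · exact restrict_of_mem hh _
  · rw [restrict_of_notMem hh, basisVec_of_ne]
    rintro rfl
    exact hh hg

theorem restrict_basisVec_of_notMem {A : Set G} {g : G} (hg : g ∉ A) :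
    restrict A (basisVec g) = 0 := by
  refine lp.ext (funext fun h => ?_)
  by_cases hh : h ∈ A
  · rw [restrict_of_mem hh, basisVec_of_ne]
    · rfl
    · rintro rfl
      exact hg hh
  · exact restrict_of_notMem hh _

theorem restrict_restrict_of_subset {A B : Set G} (h : A ⊆ B) (ξ : L2 G) :
    restrict A (restrict B ξ) = restrict A ξ := by
  refine lp.ext (funext fun g => ?_)
  by_cases hg : g ∈ A
  · rw [restrict_of_mem hg, restrict_of_mem hg, restrict_of_mem (h hg)]
  · rw [restrict_of_notMem hg, restrict_of_notMem hg]

theorem apply_eq_zero_of_norm_le_norm_restrict {A : Set G} {ξ : L2 G}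
    (h : ‖ξ‖ ≤ ‖restrict A ξ‖) {g : G} (hg : g ∉ A) : ξ g = 0 := by
  have h1 := hasSum_norm_sq ξ
  have h2 := hasSum_norm_sq (restrict A ξ)
  have h3 := h1.sub h2
  have hle : ∀ k, 0 ≤ ‖ξ k‖ ^ 2 - ‖restrict A ξ k‖ ^ 2 := fun k => by
    have := norm_indicator_le_norm_self (s := A) ξ k
    rw [restrict_apply, sub_nonneg]
    gcongr
  have h4 := le_hasSum h3 g fun k _ => hle k
  have h5 : ‖ξ‖ ^ 2 ≤ ‖restrict A ξ‖ ^ 2 := by gcongr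
  rw [restrict_of_notMem hg, norm_zero] at h4
  have h6 : ‖ξ g‖ ^ 2 = 0 := le_antisymm (by linarith) (sq_nonneg _)
  simpa using h6

theorem sum_norm_restrict_sq_le (q : G → ι) (ξ : L2 G) (T : Finset ι) :
    ∑ t ∈ T, ‖restrict (q ⁻¹' {t}) ξ‖ ^ 2 ≤ ‖ξ‖ ^ 2 := by
  classical
  refine hasSum_le (fun g => ?_)
    (hasSum_sum fun t _ => hasSum_norm_sq (restrict (q ⁻¹' {t}) ξ)) (hasSum_norm_sq ξ)
  calc ∑ t ∈ T, ‖restrict (q ⁻¹' {t}) ξ g‖ ^ 2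
      = ∑ t ∈ T, if q g = t then ‖ξ g‖ ^ 2 else 0 := by
        refine Finset.sum_congr rfl fun t _ => ?_
        split_ifs with h
        · rw [restrict_of_mem (by simpa using h)]
        · rw [restrict_of_notMem (by simpa using h)]
          simp
    _ ≤ ‖ξ g‖ ^ 2 := by
        rw [Finset.sum_ite_eq]
        split_ifs
        · rfl
        · positivity

/-- The pieces of `ξ` over distinct fibres are orthogonal and `x` is bounded on each. This makes
`blockDiag` well defined and norm-decreasing. -/
theorem sum_blockDiag_le (q : G → ι) (x : L2 G →L[ℂ] L2 G) (ξ : L2 G) (s : Finset G) :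
    ∑ g ∈ s, ‖x (restrict (q ⁻¹' {q g}) ξ) g‖ ^ 2 ≤ (‖x‖ * ‖ξ‖) ^ 2 := by
  classical
  calc ∑ g ∈ s, ‖x (restrict (q ⁻¹' {q g}) ξ) g‖ ^ 2
      = ∑ t ∈ s.image q, ∑ g ∈ s with q g = t, ‖x (restrict (q ⁻¹' {q g}) ξ) g‖ ^ 2 :=
        (Finset.sum_fiberwise_of_maps_to (fun g hg => Finset.mem_image_of_mem q hg) _).symm
    _ = ∑ t ∈ s.image q, ∑ g ∈ s with q g = t, ‖x (restrict (q ⁻¹' {t}) ξ) g‖ ^ 2 := by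
        refine Finset.sum_congr rfl fun t _ => Finset.sum_congr rfl fun g hg => ?_
        rw [(Finset.mem_filter.1 hg).2]
    _ ≤ ∑ t ∈ s.image q, ‖x‖ ^ 2 * ‖restrict (q ⁻¹' {t}) ξ‖ ^ 2 := by
        refine Finset.sum_le_sum fun t _ => (sum_norm_sq_le _ _).trans ?_
        rw [← mul_pow]
        gcongr
        exact x.le_opNorm _
    _ ≤ (‖x‖ * ‖ξ‖) ^ 2 := by
        rw [← Finset.mul_sum, mul_pow]
        gcongr
        exact sum_norm_restrict_sq_le q ξ _

/-- The block diagonal part of an operator on `ℓ²(G)`, with respect to the partition of `G` into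
the fibres of `q`. -/
def blockDiag (q : G → ι) (x : L2 G →L[ℂ] L2 G) : L2 G →L[ℂ] L2 G :=
  LinearMap.mkContinuous
    { toFun := fun ξ => ⟨fun g => x (restrict (q ⁻¹' {q g}) ξ) g,
        memℓp_gen' (C := (‖x‖ * ‖ξ‖) ^ 2) fun s => by simpa using sum_blockDiag_le q x ξ s⟩
      map_add' := fun ξ η => lp.ext (funext fun g => by simp; rfl)
      map_smul' := fun c ξ => lp.ext (funext fun g => by simp) } ‖x‖ fun ξ => by
    refine lp.norm_le_of_forall_sum_le (by norm_num) (by positivity) fun s => ?_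
    simpa using sum_blockDiag_le q x ξ s

theorem blockDiag_apply (q : G → ι) (x : L2 G →L[ℂ] L2 G) (ξ : L2 G) (g : G) :
    blockDiag q x ξ g = x (restrict (q ⁻¹' {q g}) ξ) g := rfl

theorem norm_blockDiag_le (q : G → ι) (x : L2 G →L[ℂ] L2 G) : ‖blockDiag q x‖ ≤ ‖x‖ :=
  LinearMap.mkContinuous_norm_le _ (norm_nonneg _) _

theorem restrict_blockDiag (q : G → ι) (x : L2 G →L[ℂ] L2 G) (ξ : L2 G) (t : ι) :
    restrict (q ⁻¹' {t}) (blockDiag q x ξ) =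
      restrict (q ⁻¹' {t}) (x (restrict (q ⁻¹' {t}) ξ)) := by
  refine lp.ext (funext fun g => ?_)
  by_cases hg : g ∈ q ⁻¹' {t}
  · rw [restrict_of_mem hg, restrict_of_mem hg, blockDiag_apply, show q g = t from hg]
  · rw [restrict_of_notMem hg, restrict_of_notMem hg]

theorem blockDiag_mul_mul (q : G → ι) {a x b : L2 G →L[ℂ] L2 G}
    (ha : ∀ t, restrict (q ⁻¹' {t}) * a = a * restrict (q ⁻¹' {t}))
    (hb : ∀ t, restrict (q ⁻¹' {t}) * b = b * restrict (q ⁻¹' {t})) :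
    blockDiag q (a * x * b) = a * blockDiag q x * b := by
  refine ContinuousLinearMap.ext fun ξ => lp.ext (funext fun g => ?_)
  have ha' : ∀ t η, restrict (q ⁻¹' {t}) (a η) = a (restrict (q ⁻¹' {t}) η) := fun t η =>
    congrArg (fun z : L2 G →L[ℂ] L2 G => z η) (ha t)
  have hb' : ∀ t η, restrict (q ⁻¹' {t}) (b η) = b (restrict (q ⁻¹' {t}) η) := fun t η =>
    congrArg (fun z : L2 G →L[ℂ] L2 G => z η) (hb t)
  have hg : g ∈ q ⁻¹' {q g} := rfl
  calc a (x (b (restrict (q ⁻¹' {q g}) ξ))) g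
      = restrict (q ⁻¹' {q g}) (a (x (b (restrict (q ⁻¹' {q g}) ξ)))) g :=
        (restrict_of_mem hg _).symm
    _ = restrict (q ⁻¹' {q g}) (a (blockDiag q x (b ξ))) g := by
        rw [ha', ha', restrict_blockDiag, hb']
    _ = a (blockDiag q x (b ξ)) g := restrict_of_mem hg _

theorem tsum_indicator_fiber_eq (q : G → ι) {f : G → ℂ} {a : ℂ} (h : HasSum f a) :
    ∑' t, ∑' g, (q ⁻¹' {t}).indicator f g = a := by
  rw [← (h.tsum_fiberwise q).tsum_eq]
  exact tsum_congr fun t => (tsum_subtype (q ⁻¹' {t}) f).symm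

/-- The quadratic form of the block diagonal part is the sum over the fibres of the form of `x` on
the pieces of `ξ`. -/
theorem isPositive_blockDiag (q : G → ι) {x : L2 G →L[ℂ] L2 G} (hx : x.IsPositive) :
    (blockDiag q x).IsPositive := by
  have key : ∀ ξ, inner ℂ (blockDiag q x ξ) ξ =
      ∑' t, inner ℂ (x (restrict (q ⁻¹' {t}) ξ)) (restrict (q ⁻¹' {t}) ξ) := by
    intro ξ
    refine (tsum_indicator_fiber_eq q (lp.hasSum_inner (blockDiag q x ξ) ξ)).symm.trans ?_
    refine tsum_congr fun t => ?_
    rw [lp.inner_eq_tsum]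
    refine tsum_congr fun g => ?_
    by_cases hg : g ∈ q ⁻¹' {t}
    · rw [Set.indicator_of_mem hg, restrict_of_mem hg, blockDiag_apply, show q g = t from hg]
    · rw [Set.indicator_of_notMem hg, restrict_of_notMem hg, inner_zero_right]
  have hnn : ∀ ξ, ((inner ℂ (blockDiag q x ξ) ξ).re : ℂ) = inner ℂ (blockDiag q x ξ) ξ ∧
      0 ≤ (inner ℂ (blockDiag q x ξ) ξ).re := by
    intro ξ
    have hx' := fun t => ((ContinuousLinearMap.isPositive_iff_complex x).1 hx)
      (restrict (q ⁻¹' {t}) ξ)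
    have h : inner ℂ (blockDiag q x ξ) ξ =
      ((∑' t, (inner ℂ (x (restrict (q ⁻¹' {t}) ξ)) (restrict (q ⁻¹' {t}) ξ)).re : ℝ) : ℂ) := by
      rw [key, Complex.ofReal_tsum]
      exact tsum_congr fun t => ((hx' t).1).symm
    rw [h, Complex.ofReal_re]
    exact ⟨rfl, tsum_nonneg fun t => (hx' t).2⟩
  exact (ContinuousLinearMap.isPositive_iff_complex _).2 hnn

end Index

/-! ### Group von Neumann algebras: Fourier coefficients and the trace. -/

section Regular

variable {G : Type*} [Group G]

theorem delta_eq_basisVec : delta G = basisVec 1 := rfl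

theorem lam_apply (g : G) (ξ : L2 G) (k : G) : lam g ξ k = ξ (g⁻¹ * k) := rfl

theorem norm_lam_apply (g : G) (ξ : L2 G) : ‖lam g ξ‖ = ‖ξ‖ := by
  have h := (Equiv.mulLeft g⁻¹).hasSum_iff.2 (hasSum_norm_sq ξ)
  exact (sq_eq_sq₀ (norm_nonneg _) (norm_nonneg _)).1 ((hasSum_norm_sq (lam g ξ)).unique h)

theorem lam_one : lam (1 : G) = 1 :=
  ContinuousLinearMap.ext fun ξ => lp.ext (funext fun k => by simp [lam_apply])

theorem lam_mul (g h : G) : lam (g * h) = lam g * lam h :=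
  ContinuousLinearMap.ext fun ξ => lp.ext (funext fun k => by simp [lam_apply, mul_assoc])

theorem lam_basisVec (g h : G) : lam g (basisVec h) = basisVec (g * h) := by
  refine lp.ext (funext fun k => ?_)
  rw [lam_apply]
  by_cases hk : k = g * h
  · rw [hk, inv_mul_cancel_left, basisVec_self, basisVec_self]
  · rw [basisVec_of_ne hk, basisVec_of_ne]
    rintro rfl
    simp at hk

theorem star_lam (g : G) : star (lam g) = lam g⁻¹ := by
  refine ext_basisVec fun m k => ?_
  rw [star_apply_basisVec, lam_basisVec, lam_basisVec]
  by_cases h : m = g * k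
  · rw [h, inv_mul_cancel_left, basisVec_self, basisVec_self, star_one]
  · rw [basisVec_of_ne h, basisVec_of_ne, star_zero]
    rintro rfl
    simp at h

theorem lam_mul_lam_inv (g : G) : lam g * lam g⁻¹ = 1 := by
  rw [← lam_mul, mul_inv_cancel, lam_one]

theorem lam_inv_mul_lam (g : G) : lam g⁻¹ * lam g = 1 := by
  rw [← lam_mul, inv_mul_cancel, lam_one]

/-- The right regular representation: `(rho g ξ) x = ξ (x g)` on `ℓ²(G)`. -/
def rho (g : G) : L2 G →L[ℂ] L2 G :=
  LinearIsometry.toContinuousLinearMap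
    { toFun := fun ξ => ⟨fun x => ξ (x * g), by
        have h := (memℓp_gen_iff (p := 2) (by norm_num)).1 (lp.memℓp ξ)
        exact (memℓp_gen_iff (p := 2) (by norm_num)).2
          (h.comp_injective (mul_left_injective g))⟩
      map_add' := fun _ _ => rfl
      map_smul' := fun _ _ => rfl
      norm_map' := fun ξ => by
        rw [lp.norm_eq_tsum_rpow (by norm_num), lp.norm_eq_tsum_rpow (by norm_num)]
        congr 1
        exact (Equiv.mulRight g).tsum_eq (fun x => ‖ξ x‖ ^ (2 : ENNReal).toReal) }

theorem rho_apply (g : G) (ξ : L2 G) (k : G) : rho g ξ k = ξ (k * g) := rfl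

theorem rho_basisVec (g : G) : rho g⁻¹ (basisVec 1) = basisVec g := by
  refine lp.ext (funext fun k => ?_)
  rw [rho_apply]
  by_cases hk : k = g
  · rw [hk, mul_inv_cancel, basisVec_self, basisVec_self]
  · rw [basisVec_of_ne hk, basisVec_of_ne]
    rwa [Ne, mul_inv_eq_one]

theorem lam_mul_rho (g h : G) : lam g * rho h = rho h * lam g :=
  ContinuousLinearMap.ext fun ξ => lp.ext (funext fun k => by
    simp [lam_apply, rho_apply, mul_assoc])

/-- Adjoints drop out of the double commutant because `lam '' K` is closed under `star`. -/
theorem mem_vN_iff {K : Subgroup G} {z : L2 G →L[ℂ] L2 G} :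
    z ∈ vN K ↔ ∀ y, (∀ k ∈ K, lam k * y = y * lam k) → y * z = z * y := by
  have hc : ∀ y, y ∈ StarSubalgebra.centralizer ℂ (lam '' (K : Set G)) ↔
      ∀ k ∈ K, lam k * y = y * lam k := by
    intro y
    rw [StarSubalgebra.mem_centralizer_iff]
    constructor
    · exact fun h k hk => (h _ ⟨k, hk, rfl⟩).1
    · rintro h _ ⟨k, hk, rfl⟩
      rw [star_lam]
      exact ⟨h k hk, h _ (inv_mem hk)⟩
  have hz : z ∈ vN K ↔ z ∈ StarSubalgebra.centralizer ℂ
    (StarSubalgebra.centralizer ℂ (lam '' (K : Set G)) : Set (L2 G →L[ℂ] L2 G)) := Iff.rfl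
  rw [hz, StarSubalgebra.mem_centralizer_iff]
  constructor
  · exact fun h y hy => (h y ((hc y).2 hy)).1
  · exact fun h y hy => ⟨h y ((hc y).1 hy), h _ ((hc _).1
      ((StarSubalgebra.centralizer ℂ (lam '' (K : Set G))).star_mem' hy))⟩

theorem lam_mem_vN {K : Subgroup G} {k : G} (hk : k ∈ K) : lam k ∈ vN K :=
  mem_vN_iff.2 fun _ hy => (hy k hk).symm

theorem vN_mono {K L : Subgroup G} (h : K ≤ L) : vN K ≤ vN L :=
  fun _ hz => mem_vN_iff.2 fun y hy => mem_vN_iff.1 hz y fun k hk => hy k (h hk)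

theorem centralizer_centralizer_lam (K : Subgroup G) :
    Set.centralizer (Set.centralizer (lam '' (K : Set G))) =
      (vN K : Set (L2 G →L[ℂ] L2 G)) := by
  ext z
  rw [SetLike.mem_coe, mem_vN_iff, Set.mem_centralizer_iff]
  simp [Set.mem_centralizer_iff]

/-- The projection onto `ℓ²` of a left `K`-invariant set commutes with each `lam k`, so it lies in
the commutant of `L(K)`. -/
theorem restrict_mul_comm {K : Subgroup G} {A : Set G} (hA : ∀ k ∈ K, ∀ g, k * g ∈ A ↔ g ∈ A)
    {z : L2 G →L[ℂ] L2 G} (hz : z ∈ vN K) : restrict A * z = z * restrict A := by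
  refine mem_vN_iff.1 hz _ fun k hk => ContinuousLinearMap.ext fun ξ => lp.ext (funext fun g => ?_)
  change restrict A ξ (k⁻¹ * g) = restrict A (lam k ξ) g
  by_cases hg : g ∈ A
  · rw [restrict_of_mem hg, restrict_of_mem ((hA _ (inv_mem hk) g).2 hg), lam_apply]
  · rw [restrict_of_notMem hg, restrict_of_notMem (mt (hA _ (inv_mem hk) g).1 hg)]

theorem restrict_apply_comm {K : Subgroup G} {A : Set G}
    (hA : ∀ k ∈ K, ∀ g, k * g ∈ A ↔ g ∈ A) {z : L2 G →L[ℂ] L2 G} (hz : z ∈ vN K) (ξ : L2 G) :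
    restrict A (z ξ) = z (restrict A ξ) :=
  congrArg (fun w : L2 G →L[ℂ] L2 G => w ξ) (restrict_mul_comm hA hz)

theorem mul_mem_coe_iff (K : Subgroup G) : ∀ k ∈ K, ∀ g, k * g ∈ (K : Set G) ↔ g ∈ (K : Set G) :=
  fun _ hk _ => K.mul_mem_cancel_left hk

/-- Right translations lie in the commutant and carry `δ` to every basis vector. -/
theorem apply_basisVec_of_mem_vN {K : Subgroup G} {z : L2 G →L[ℂ] L2 G} (hz : z ∈ vN K) (m g : G) :
    z (basisVec m) g = z (delta G) (g * m⁻¹) := by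
  have h := mem_vN_iff.1 hz (rho m⁻¹) fun k _ => lam_mul_rho k _
  have h' := congrArg (fun w : L2 G →L[ℂ] L2 G => w (basisVec 1)) h
  change rho m⁻¹ (z (basisVec 1)) = z (rho m⁻¹ (basisVec 1)) at h'
  rw [← rho_basisVec m, ← h']
  rfl

theorem restrict_delta_of_mem_vN {K : Subgroup G} {z : L2 G →L[ℂ] L2 G} (hz : z ∈ vN K) :
    restrict (K : Set G) (z (delta G)) = z (delta G) := by
  rw [restrict_apply_comm (mul_mem_coe_iff K) hz, delta_eq_basisVec,
    restrict_basisVec_of_mem K.one_mem]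

/-- Formally `z = ∑ f k • lam k`. For `y` commuting with `lam k`, `k ∈ K`, the entries of `y z` and
`z y` are the sums over `k` of `f k` times an entry of `y (lam k)` and of `(lam k) y`, hence agree
termwise. -/
theorem mem_vN_of_matrix {K : Subgroup G} {z : L2 G →L[ℂ] L2 G} (f : G → ℂ)
    (hf : ∀ g, g ∉ K → f g = 0) (hz : ∀ m g, z (basisVec m) g = f (g * m⁻¹)) : z ∈ vN K := by
  refine mem_vN_iff.2 fun y hy => ext_basisVec fun m g => ?_
  have h1 := (Equiv.mulRight m).hasSum_iff.2 (hasSum_map_apply y (z (basisVec m)) g)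
  have h2 := ((Equiv.inv G).trans (Equiv.mulRight g)).hasSum_iff.2
    (hasSum_map_apply z (y (basisVec m)) g)
  refine h1.unique (h2.congr_fun fun k => ?_)
  simp only [Function.comp_apply, Equiv.coe_mulRight, Equiv.trans_apply, Equiv.inv_apply, hz,
    mul_inv_cancel_right, mul_inv_rev, inv_inv, mul_inv_cancel_left]
  by_cases hk : k ∈ K
  · have h := congrArg (fun w : L2 G →L[ℂ] L2 G => w (basisVec m) g) (hy k hk)
    change y (basisVec m) (k⁻¹ * g) = y (lam k (basisVec m)) g at h
    rw [lam_basisVec] at h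
    rw [h, mul_comm]
  · rw [hf k hk, zero_mul, mul_zero]

theorem mem_vN_iff_of_mem_vN_top {K : Subgroup G} {z : L2 G →L[ℂ] L2 G}
    (hz : z ∈ vN (⊤ : Subgroup G)) : z ∈ vN K ↔ ∀ g, g ∉ K → z (delta G) g = 0 := by
  refine ⟨fun h g hg => ?_, fun h =>
    mem_vN_of_matrix (z (delta G)) h fun m g => apply_basisVec_of_mem_vN hz m g⟩
  rw [← restrict_delta_of_mem_vN h]
  exact restrict_of_notMem hg _

theorem ext_delta {x y : L2 G →L[ℂ] L2 G} (hx : x ∈ vN (⊤ : Subgroup G))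
    (hy : y ∈ vN (⊤ : Subgroup G)) (h : x (delta G) = y (delta G)) : x = y :=
  ext_basisVec fun m g => by
    rw [apply_basisVec_of_mem_vN hx, apply_basisVec_of_mem_vN hy, h]

theorem star_apply_delta {x : L2 G →L[ℂ] L2 G} (hx : x ∈ vN (⊤ : Subgroup G)) (g : G) :
    star x (delta G) g = star (x (delta G) g⁻¹) := by
  rw [delta_eq_basisVec, star_apply_basisVec, apply_basisVec_of_mem_vN hx, one_mul,
    delta_eq_basisVec]

theorem norm_star_apply_delta {x : L2 G →L[ℂ] L2 G} (hx : x ∈ vN (⊤ : Subgroup G)) :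
    ‖star x (delta G)‖ = ‖x (delta G)‖ := by
  have h := (Equiv.inv G).hasSum_iff.2 (hasSum_norm_sq (x (delta G)))
  have h' := hasSum_norm_sq (star x (delta G))
  simp only [star_apply_delta hx, norm_star] at h'
  exact (sq_eq_sq₀ (norm_nonneg _) (norm_nonneg _)).1 (h'.unique h)

/-- Right multiplication is bounded in the 2-norm: pass to adjoints, which preserve that norm, so
that `b` becomes a left factor. -/
theorem norm_mul_apply_delta_le {a b : L2 G →L[ℂ] L2 G} (ha : a ∈ vN (⊤ : Subgroup G))
    (hb : b ∈ vN (⊤ : Subgroup G)) : ‖a (b (delta G))‖ ≤ ‖b‖ * ‖a (delta G)‖ := by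
  have h := norm_star_apply_delta (mul_mem ha hb)
  rw [star_mul] at h
  calc ‖a (b (delta G))‖ = ‖star b (star a (delta G))‖ := h.symm
    _ ≤ ‖star b‖ * ‖star a (delta G)‖ := ContinuousLinearMap.le_opNorm _ _
    _ = ‖b‖ * ‖a (delta G)‖ := by
      rw [norm_star_apply_delta ha, ContinuousLinearMap.star_eq_adjoint,
        LinearIsometryEquiv.norm_map]

theorem hasSum_inner_delta_mul {x y : L2 G →L[ℂ] L2 G} (hx : x ∈ vN (⊤ : Subgroup G)) :
    HasSum (fun g => x (delta G) g⁻¹ * y (delta G) g) (inner ℂ (delta G) (x (y (delta G)))) := by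
  have h := lp.hasSum_inner (𝕜 := ℂ) (G := fun _ : G => ℂ) (star x (delta G)) (y (delta G))
  rw [ContinuousLinearMap.star_eq_adjoint, ContinuousLinearMap.adjoint_inner_left,
    ← ContinuousLinearMap.star_eq_adjoint] at h
  refine h.congr_fun fun g => ?_
  rw [star_apply_delta hx]
  simp [mul_comm]

theorem trace_apply (x : (vN (⊤ : Subgroup G)).toStarSubalgebra) :
    trace G x = inner ℂ (delta G) ((x : L2 G →L[ℂ] L2 G) (delta G)) := rfl

theorem trace_star_mul_self (x : (vN (⊤ : Subgroup G)).toStarSubalgebra) :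
    trace G (star x * x) = ((‖(x : L2 G →L[ℂ] L2 G) (delta G)‖ ^ 2 : ℝ) : ℂ) := by
  rw [trace_apply]
  change inner ℂ (delta G) (star (x : L2 G →L[ℂ] L2 G) ((x : L2 G →L[ℂ] L2 G) (delta G))) = _
  rw [ContinuousLinearMap.star_eq_adjoint, ContinuousLinearMap.adjoint_inner_right,
    inner_self_eq_norm_sq_to_K]
  simp

theorem twoNorm_trace (x : (vN (⊤ : Subgroup G)).toStarSubalgebra) :
    twoNorm (trace G) x = ‖(x : L2 G →L[ℂ] L2 G) (delta G)‖ := by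
  rw [twoNorm, trace_star_mul_self, Complex.ofReal_re, Real.sqrt_sq (norm_nonneg _)]

theorem isFaithfulNormalTrace_trace : IsFaithfulNormalTrace (trace G) where
  map_one := by
    rw [trace_apply]
    change inner ℂ (delta G) (delta G) = 1
    rw [inner_self_eq_norm_sq_to_K, delta_eq_basisVec, norm_basisVec]
    simp
  nonneg x := by
    rw [trace_star_mul_self, Complex.ofReal_re, Complex.ofReal_im]
    exact ⟨by positivity, rfl⟩
  tracial x y := by
    have h1 := hasSum_inner_delta_mul (y := y) x.2
    have h2 := (Equiv.inv G).hasSum_iff.2 (hasSum_inner_delta_mul (y := x) y.2)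
    refine h1.unique (h2.congr_fun fun g => ?_)
    simp [mul_comm]
  faithful x hx := by
    rw [trace_star_mul_self, Complex.ofReal_eq_zero, sq_eq_zero_iff, norm_eq_zero] at hx
    exact Subtype.ext (ext_delta x.2 (zero_mem _) hx)
  normal := by
    have hs : Summable fun n : ℕ => ‖(if n = 0 then delta G else 0 : L2 G)‖ ^ 2 :=
      summable_of_ne_finset_zero (s := {0}) fun n hn => by
        rw [if_neg (by simpa using hn)]
        simp
    refine ⟨fun n => if n = 0 then delta G else 0, fun n => if n = 0 then delta G else 0,
      hs, hs, fun x => ?_⟩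
    convert hasSum_ite_eq (0 : ℕ) (trace G x) using 2 with n
    split_ifs with hn
    · simp only [if_pos hn]
      rfl
    · simp only [if_neg hn, inner_zero_left]

end Regular

/-! ### Conditional expectations as block diagonal parts along right cosets. -/

section Expectation

variable {G : Type*} [Group G]

/-- The projection of `G` onto the set of right cosets `K g`. -/
def coset (K : Subgroup G) (g : G) : Quotient (QuotientGroup.rightRel K) :=
  Quotient.mk _ g

theorem coset_eq_iff {K : Subgroup G} {g h : G} : coset K g = coset K h ↔ h * g⁻¹ ∈ K :=
  Quotient.eq.trans QuotientGroup.rightRel_apply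

theorem coset_mul_left {K : Subgroup G} {k : G} (hk : k ∈ K) (g : G) :
    coset K (k * g) = coset K g := by
  rw [eq_comm, coset_eq_iff, mul_inv_cancel_right]
  exact hk

theorem mul_mem_coset_iff (K : Subgroup G) (t : Quotient (QuotientGroup.rightRel K)) :
    ∀ k ∈ K, ∀ g, k * g ∈ coset K ⁻¹' {t} ↔ g ∈ coset K ⁻¹' {t} := fun k hk g => by
  rw [Set.mem_preimage, Set.mem_preimage, coset_mul_left hk]

theorem coset_preimage_one (K : Subgroup G) : coset K ⁻¹' {coset K 1} = (K : Set G) := by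
  ext g
  rw [Set.mem_preimage, Set.mem_singleton_iff, eq_comm, coset_eq_iff]
  simp

/-- The block diagonal part of an operator along the right cosets of `K`; on `L(G)` this is the
conditional expectation onto `L(K)`. -/
abbrev cosetDiag (K : Subgroup G) (x : L2 G →L[ℂ] L2 G) : L2 G →L[ℂ] L2 G :=
  blockDiag (coset K) x

theorem cosetDiag_apply_basisVec (K : Subgroup G) (x : L2 G →L[ℂ] L2 G) (m g : G) :
    cosetDiag K x (basisVec m) g = (K : Set G).indicator (fun _ => x (basisVec m) g) (g * m⁻¹) := by
  rw [blockDiag_apply]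
  by_cases h : g * m⁻¹ ∈ K
  · rw [Set.indicator_of_mem (by exact h), restrict_basisVec_of_mem]
    exact coset_eq_iff.2 h
  · rw [Set.indicator_of_notMem (by exact h), restrict_basisVec_of_notMem]
    · simp
    · exact fun h' => h (coset_eq_iff.1 h')

theorem cosetDiag_mem_vN (K : Subgroup G) {x : L2 G →L[ℂ] L2 G} (hx : x ∈ vN (⊤ : Subgroup G)) :
    cosetDiag K x ∈ vN K := by
  refine mem_vN_of_matrix ((K : Set G).indicator (x (delta G)))
    (fun g hg => Set.indicator_of_notMem (by exact hg) _) fun m g => ?_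
  rw [cosetDiag_apply_basisVec, apply_basisVec_of_mem_vN hx]
  rfl

theorem cosetDiag_mem_vN_top (K : Subgroup G) {x : L2 G →L[ℂ] L2 G}
    (hx : x ∈ vN (⊤ : Subgroup G)) : cosetDiag K x ∈ vN (⊤ : Subgroup G) :=
  vN_mono le_top (cosetDiag_mem_vN K hx)

theorem cosetDiag_apply_delta (K : Subgroup G) (x : L2 G →L[ℂ] L2 G) :
    cosetDiag K x (delta G) = restrict (K : Set G) (x (delta G)) := by
  refine lp.ext (funext fun g => ?_)
  rw [delta_eq_basisVec, cosetDiag_apply_basisVec, restrict_apply, inv_one, mul_one]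
  rfl

theorem cosetDiag_of_mem {K : Subgroup G} {x : L2 G →L[ℂ] L2 G} (hx : x ∈ vN K) :
    cosetDiag K x = x := by
  have hx' := vN_mono le_top hx
  refine ext_delta (cosetDiag_mem_vN_top K hx') hx' ?_
  rw [cosetDiag_apply_delta, restrict_delta_of_mem_vN hx]

theorem restrict_cosetDiag (K : Subgroup G) (x : L2 G →L[ℂ] L2 G) (ξ : L2 G) :
    restrict (K : Set G) (cosetDiag K x ξ) =
      restrict (K : Set G) (x (restrict (K : Set G) ξ)) := by
  have h := restrict_blockDiag (coset K) x ξ (coset K 1)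
  rwa [coset_preimage_one] at h

/-- The trace-preserving conditional expectation of `L(G)` onto `L(K)`. -/
def condExp (K : Subgroup G) :
    (vN (⊤ : Subgroup G)).toStarSubalgebra →ₗ[ℂ] (vN (⊤ : Subgroup G)).toStarSubalgebra where
  toFun x := ⟨cosetDiag K x, cosetDiag_mem_vN_top K x.2⟩
  map_add' _ _ := Subtype.ext (ContinuousLinearMap.ext fun _ => rfl)
  map_smul' _ _ := Subtype.ext (ContinuousLinearMap.ext fun _ => rfl)

theorem coe_condExp (K : Subgroup G) (x : (vN (⊤ : Subgroup G)).toStarSubalgebra) :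
    (condExp K x : L2 G →L[ℂ] L2 G) = cosetDiag K x := rfl

theorem isCondExp_condExp (K : Subgroup G) : IsCondExp (trace G) (vN K) (condExp K) where
  mem x := cosetDiag_mem_vN K x.2
  apply_of_mem _ hx := Subtype.ext (cosetDiag_of_mem hx)
  positive _ hx := isPositive_blockDiag _ hx
  bimodule a x b ha hb := Subtype.ext <| blockDiag_mul_mul (coset K)
    (fun t => restrict_mul_comm (mul_mem_coset_iff K t) ha)
    (fun t => restrict_mul_comm (mul_mem_coset_iff K t) hb)
  trace_preserving x := by
    rw [trace_apply, trace_apply, coe_condExp, cosetDiag_apply_delta]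
    simp only [delta_eq_basisVec, inner_basisVec_left]
    exact restrict_of_mem K.one_mem _

/-- Expanding the right side, both cross terms equal the term with two expectations: `L(H)` commutes
with restriction to `H`, and on vectors supported on `H` the operators `x` and `cosetDiag H x` agree
after restriction to `H`. -/
theorem restrict_mul_mul_sub {F H : Subgroup G} (hFH : F ≤ H) {x u y : L2 G →L[ℂ] L2 G}
    (hx : x ∈ vN (⊤ : Subgroup G)) (hu : u ∈ vN H) (hy : y ∈ vN (⊤ : Subgroup G)) :
    restrict (F : Set G) (x (u (y (delta G)))) -
        restrict (F : Set G) (cosetDiag H x (u (cosetDiag H y (delta G)))) =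
      restrict (F : Set G)
        ((x - cosetDiag H x) (u ((y - cosetDiag H y) (delta G)))) := by
  have hFH' : (F : Set G) ⊆ H := hFH
  have hEx := cosetDiag_mem_vN H hx
  have h1 : restrict (F : Set G) (cosetDiag H x (u (y (delta G)))) =
      restrict (F : Set G) (cosetDiag H x (u (cosetDiag H y (delta G)))) := by
    rw [← restrict_restrict_of_subset hFH', restrict_apply_comm (mul_mem_coe_iff H) hEx,
      restrict_apply_comm (mul_mem_coe_iff H) hu, ← cosetDiag_apply_delta]
  have h2 : restrict (F : Set G) (x (u (cosetDiag H y (delta G)))) =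
      restrict (F : Set G) (cosetDiag H x (u (cosetDiag H y (delta G)))) := by
    have h3 := restrict_cosetDiag H x (u (cosetDiag H y (delta G)))
    rw [restrict_apply_comm (mul_mem_coe_iff H) hu,
      restrict_delta_of_mem_vN (cosetDiag_mem_vN H hy)] at h3
    rw [← restrict_restrict_of_subset hFH', ← h3, restrict_restrict_of_subset hFH']
  simp only [sub_apply, map_sub, h1, h2]
  abel

theorem cosetDiag_sub_apply_delta {H : Subgroup G} (x : L2 G →L[ℂ] L2 G) :
    ∀ g ∈ (H : Set G), (x - cosetDiag H x) (delta G) g = 0 := fun g hg => by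
  change x (delta G) g - cosetDiag H x (delta G) g = 0
  rw [cosetDiag_apply_delta, restrict_of_mem hg, sub_self]

theorem restrict_sum_lam_eq_zero {F : Subgroup G} (s t : Finset G) (c d : G → ℂ) {f : G}
    (h : ∀ g ∈ s, ∀ k ∈ t, g * f * k ∉ F) :
    restrict (F : Set G) ((∑ g ∈ s, c g • lam g) (lam f (∑ k ∈ t, d k • basisVec k))) = 0 := by
  rw [map_sum, map_sum, map_sum]
  refine Finset.sum_eq_zero fun k hk => ?_
  rw [map_smul, map_smul, map_smul, lam_basisVec, sum_apply, map_sum]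
  rw [Finset.sum_eq_zero fun g hg => ?_, smul_zero]
  rw [smul_apply, map_smul, lam_basisVec, restrict_basisVec_of_notMem, smul_zero]
  rw [← mul_assoc]
  exact h g hg k hk

theorem sum_lam_mem (s : Finset G) (c : G → ℂ) :
    ∑ g ∈ s, c g • lam g ∈ vN (⊤ : Subgroup G) :=
  sum_mem fun g _ => (vN (⊤ : Subgroup G)).toStarSubalgebra.smul_mem
    (lam_mem_vN (Subgroup.mem_top g)) _

theorem sum_lam_apply_delta (s : Finset G) (c : G → ℂ) :
    (∑ g ∈ s, c g • lam g) (delta G) = ∑ g ∈ s, c g • basisVec g := by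
  simp [sum_apply, delta_eq_basisVec, lam_basisVec]

/-! ### The asymptotic estimate and the normalizer. -/

theorem exists_norm_restrict_lt {F H : Subgroup G}
    (hP : ∀ S : Finset G, (∀ g ∈ S, g ∉ H) → ∃ f ∈ F, ∀ g ∈ S, ∀ h ∈ S, g * f * h ∉ F)
    {n : ℕ} (x : Fin n → L2 G →L[ℂ] L2 G) (hx : ∀ i, x i ∈ vN (⊤ : Subgroup G))
    (hxH : ∀ i, ∀ g ∈ (H : Set G), x i (delta G) g = 0) {ε : ℝ} (hε : 0 < ε) :
    ∃ f ∈ F, ∀ i j, ‖restrict (F : Set G) (x i (lam f (x j (delta G))))‖ < ε := by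
  classical
  have hC : ∀ j, ‖x j‖ ≤ ∑ j, ‖x j‖ := fun j =>
    Finset.single_le_sum (f := fun j => ‖x j‖) (fun _ _ => norm_nonneg _) (Finset.mem_univ j)
  set C := ∑ j, ‖x j‖ with hCdef
  have hC0 : 0 ≤ C := by positivity
  have hη : 0 < ε / (2 * (C + 1)) := by positivity
  choose s hs hsx using fun i => exists_finset_norm_sub_lt (hxH i) hη
  set A : Fin n → L2 G →L[ℂ] L2 G := fun i => ∑ g ∈ s i, x i (delta G) g • lam g with hA
  have hD : ∀ i, ‖A i‖ ≤ ∑ i, ‖A i‖ := fun i =>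
    Finset.single_le_sum (f := fun i => ‖A i‖) (fun _ _ => norm_nonneg _) (Finset.mem_univ i)
  set D := ∑ i, ‖A i‖ with hDdef
  have hD0 : 0 ≤ D := by positivity
  have hη' : 0 < ε / (2 * (D + 1)) := by positivity
  -- The right truncations come after the left ones: their precision depends on the operator norms
  -- of the `A i`, which 2-norm approximation does not control.
  choose t ht htx using fun i => exists_finset_norm_sub_lt (hxH i) hη'
  -- The hypothesis uses one finite set on both sides, hence the union of all supports.
  obtain ⟨f, hf, hfS⟩ := hP (Finset.univ.biUnion s ∪ Finset.univ.biUnion t) fun g hg => by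
    simp only [Finset.mem_union, Finset.mem_biUnion, Finset.mem_univ, true_and] at hg
    rcases hg with ⟨i, hi⟩ | ⟨i, hi⟩
    · exact hs i g hi
    · exact ht i g hi
  refine ⟨f, hf, fun i j => ?_⟩
  set B : L2 G := ∑ k ∈ t j, x j (delta G) k • basisVec k with hB
  have hzero : restrict (F : Set G) (A i (lam f B)) = 0 :=
    restrict_sum_lam_eq_zero _ _ _ _ fun g hg k hk => hfS g
      (Finset.mem_union_left _ (Finset.mem_biUnion.2 ⟨i, Finset.mem_univ _, hg⟩)) k
      (Finset.mem_union_right _ (Finset.mem_biUnion.2 ⟨j, Finset.mem_univ _, hk⟩))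
  have hsplit : restrict (F : Set G) (x i (lam f (x j (delta G)))) =
      restrict (F : Set G) ((x i - A i) ((lam f * x j) (delta G))) +
        restrict (F : Set G) (A i (lam f (x j (delta G) - B))) := by
    rw [map_sub (lam f), map_sub (A i), map_sub (restrict (F : Set G)) (A i _), hzero, sub_zero,
      ← map_add, sub_apply]
    simp
  have hlam : ‖lam f * x j‖ ≤ C := by
    refine ContinuousLinearMap.opNorm_le_bound _ hC0 fun ξ => ?_
    change ‖lam f (x j ξ)‖ ≤ _
    rw [norm_lam_apply]
    exact (x j).le_of_opNorm_le (hC j) ξ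
  have h1 : ‖restrict (F : Set G) ((x i - A i) ((lam f * x j) (delta G)))‖ ≤
      C * (ε / (2 * (C + 1))) := by
    refine (norm_restrict_le _ _).trans ((norm_mul_apply_delta_le (sub_mem (hx i) (sum_lam_mem _ _))
      (mul_mem (lam_mem_vN (Subgroup.mem_top f)) (hx j))).trans ?_)
    refine mul_le_mul hlam ?_ (norm_nonneg _) hC0
    rw [sub_apply, sum_lam_apply_delta]
    exact (hsx i).le
  have h2 : ‖restrict (F : Set G) (A i (lam f (x j (delta G) - B)))‖ ≤
      D * (ε / (2 * (D + 1))) := by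
    refine (norm_restrict_le _ _).trans (((A i).le_opNorm _).trans ?_)
    rw [norm_lam_apply]
    exact mul_le_mul (hD i) (htx j).le (norm_nonneg _) hD0
  have hlt : ∀ c : ℝ, 0 ≤ c → c * (ε / (2 * (c + 1))) < ε / 2 := fun c hc => by
    rw [← mul_div_assoc, div_lt_div_iff₀ (by positivity) (by positivity)]
    nlinarith
  rw [hsplit]
  refine (norm_add_le _ _).trans_lt ?_
  linarith [hlt C hC0, hlt D hD0]

theorem lam_mem_normalizer {F H : Subgroup G} (hFH : F ≤ H) (hN : (F.subgroupOf H).Normal)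
    {h : G} (hh : h ∈ H) : lam h ∈ normalizer (vN (⊤ : Subgroup G)) (vN F) := by
  -- Conjugation is moved to the commutant: if `y` commutes with all `lam f`, `f ∈ F`, then so does
  -- `lam k⁻¹ * y * lam k`, by normality.
  have hconj : ∀ k ∈ H, ∀ b ∈ vN F, lam k * b * lam k⁻¹ ∈ vN F := by
    intro k hk b hb
    refine mem_vN_iff.2 fun y hy => ?_
    have hy' : ∀ f ∈ F, lam f * (lam k⁻¹ * y * lam k) = lam k⁻¹ * y * lam k * lam f := by
      intro f hf
      have hf' : k * f * k⁻¹ ∈ F := by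
        have h1 := hN.conj_mem ⟨f, hFH hf⟩ hf ⟨k, hk⟩
        simpa [Subgroup.mem_subgroupOf] using h1
      have h1 : lam f * lam k⁻¹ = lam k⁻¹ * lam (k * f * k⁻¹) := by
        rw [← lam_mul, ← lam_mul]; group
      have h2 : lam k * lam f = lam (k * f * k⁻¹) * lam k := by
        rw [← lam_mul, ← lam_mul]; group
      rw [mul_assoc (_ * _) (lam k), h2, ← mul_assoc, ← mul_assoc, ← mul_assoc, h1,
        mul_assoc (lam k⁻¹) _ y, hy _ hf']
      simp only [mul_assoc]
    have h3 := mem_vN_iff.1 hb _ hy'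
    have h4 := congrArg (fun w => lam k * w * lam k⁻¹) h3
    simp only [mul_assoc, lam_mul_lam_inv, mul_one] at h4
    simp only [← mul_assoc, lam_mul_lam_inv, one_mul] at h4
    simpa only [mul_assoc] using h4
  refine ⟨lam_mem_vN (Subgroup.mem_top h), ?_, ?_⟩
  · rw [Unitary.mem_iff, star_lam]
    exact ⟨lam_inv_mul_lam h, lam_mul_lam_inv h⟩
  · ext b
    constructor
    · rintro ⟨b, hb, rfl⟩
      simp only [star_lam]
      exact hconj h hh b hb
    · intro hb
      refine ⟨lam h⁻¹ * b * lam h, ?_, ?_⟩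
      · have := hconj h⁻¹ (inv_mem hh) b hb
        rwa [inv_inv] at this
      · simp only [star_lam, mul_assoc, lam_mul_lam_inv, mul_one]
        rw [← mul_assoc, lam_mul_lam_inv, one_mul]

theorem relativeWAHP_vN {F H : Subgroup G} (hFH : F ≤ H)
    (hP : ∀ S : Finset G, (∀ g ∈ S, g ∉ H) → ∃ f ∈ F, ∀ g ∈ S, ∀ h ∈ S, g * f * h ∉ F) :
    RelativeWAHP (vN F) (vN H) (vN (⊤ : Subgroup G)) (trace G) := by
  refine ⟨vN_mono hFH, vN_mono le_top, isFaithfulNormalTrace_trace, condExp F, condExp H,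
    isCondExp_condExp F, isCondExp_condExp H, fun n x ε hε => ?_⟩
  obtain ⟨f, hf, hfx⟩ := exists_norm_restrict_lt hP
    (fun i => (x i : L2 G →L[ℂ] L2 G) - cosetDiag H (x i))
    (fun i => sub_mem (x i).2 (cosetDiag_mem_vN_top H (x i).2))
    (fun i => cosetDiag_sub_apply_delta _) hε
  refine ⟨⟨lam f, lam_mem_vN (Subgroup.mem_top f)⟩, ?_, lam_mem_vN hf, fun i j => ?_⟩
  · rw [Unitary.mem_iff]
    constructor <;> refine Subtype.ext ?_
    · change star (lam f) * lam f = 1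
      rw [star_lam, lam_inv_mul_lam]
    · change lam f * star (lam f) = 1
      rw [star_lam, lam_mul_lam_inv]
  · rw [twoNorm_trace]
    change ‖cosetDiag F (x i * lam f * x j) (delta G) -
      cosetDiag F (cosetDiag H (x i) * lam f * cosetDiag H (x j)) (delta G)‖ < ε
    rw [cosetDiag_apply_delta, cosetDiag_apply_delta]
    change ‖restrict (F : Set G) ((x i : L2 G →L[ℂ] L2 G) (lam f ((x j : L2 G →L[ℂ] L2 G)
      (delta G)))) - restrict (F : Set G) (cosetDiag H (x i) (lam f (cosetDiag H (x j)
        (delta G))))‖ < ε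
    rw [restrict_mul_mul_sub hFH (x i).2 (lam_mem_vN (hFH hf)) (x j).2]
    exact hfx i j

theorem normalizer_subset_vN {F H : Subgroup G} (hFH : F ≤ H)
    (hP : ∀ S : Finset G, (∀ g ∈ S, g ∉ H) → ∃ f ∈ F, ∀ g ∈ S, ∀ h ∈ S, g * f * h ∉ F) :
    normalizer (vN (⊤ : Subgroup G)) (vN F) ⊆ vN H := by
  rintro u ⟨hu, huu, hnorm⟩
  have hnu : ∀ ξ, ‖u ξ‖ = ‖ξ‖ := ContinuousLinearMap.norm_map_of_mem_unitary huu
  have hnsu : ∀ ξ, ‖star u ξ‖ = ‖ξ‖ :=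
    ContinuousLinearMap.norm_map_of_mem_unitary (Unitary.star_mem huu)
  have hsu : star u ∈ vN (⊤ : Subgroup G) := star_mem hu
  have hEsu : ‖cosetDiag H (star u)‖ ≤ 1 := (norm_blockDiag_le _ _).trans <|
    ContinuousLinearMap.opNorm_le_bound _ zero_le_one fun ξ => by rw [hnsu, one_mul]
  have hdelta : ‖delta G‖ = 1 := norm_basisVec 1
  -- As `ε` is arbitrary, Pythagoras then leaves no mass of `u δ` outside `H`.
  have key : ∀ ε : ℝ, 0 < ε → ‖u (delta G)‖ ≤ ‖restrict (H : Set G) (u (delta G))‖ + ε := by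
    intro ε hε
    let x : Fin 2 → L2 G →L[ℂ] L2 G := ![u, star u]
    have hx : ∀ i, x i ∈ vN (⊤ : Subgroup G) := Fin.forall_fin_two.2 ⟨hu, hsu⟩
    obtain ⟨f, hf, hfx⟩ := exists_norm_restrict_lt hP (fun i => x i - cosetDiag H (x i))
      (fun i => sub_mem (hx i) (cosetDiag_mem_vN_top H (hx i)))
      (fun i => cosetDiag_sub_apply_delta _) hε
    have h1 := hfx 0 1
    have hf1 : lam f ∈ vN F := lam_mem_vN hf
    have hft : lam f ∈ vN (⊤ : Subgroup G) := lam_mem_vN (Subgroup.mem_top f)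
    rw [← restrict_mul_mul_sub hFH (hx 0) (lam_mem_vN (hFH hf)) (hx 1)] at h1
    change ‖restrict (F : Set G) ((u * lam f * star u) (delta G)) -
      restrict (F : Set G) (cosetDiag H u ((lam f * cosetDiag H (star u)) (delta G)))‖ < ε at h1
    have h2 : u * lam f * star u ∈ vN F := by
      rw [← SetLike.mem_coe, ← hnorm]
      exact ⟨lam f, hf1, rfl⟩
    rw [restrict_delta_of_mem_vN h2] at h1
    have h3 : ‖(u * lam f * star u) (delta G)‖ = ‖u (delta G)‖ := by
      change ‖u (lam f (star u (delta G)))‖ = _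
      rw [hnu, norm_lam_apply, hnsu, hnu]
    have h4 : ‖lam f * cosetDiag H (star u)‖ ≤ 1 :=
      ContinuousLinearMap.opNorm_le_bound _ zero_le_one fun ξ => by
        change ‖lam f (cosetDiag H (star u) ξ)‖ ≤ _
        rw [norm_lam_apply]
        exact (cosetDiag H (star u)).le_of_opNorm_le hEsu ξ
    have h5 : ‖restrict (F : Set G) (cosetDiag H u ((lam f * cosetDiag H (star u)) (delta G)))‖ ≤
        ‖restrict (H : Set G) (u (delta G))‖ := by
      refine (norm_restrict_le _ _).trans ((norm_mul_apply_delta_le (cosetDiag_mem_vN_top H hu)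
        (mul_mem hft (cosetDiag_mem_vN_top H hsu))).trans ?_)
      rw [cosetDiag_apply_delta]
      exact mul_le_of_le_one_left (norm_nonneg _) h4
    have h6 := norm_sub_norm_le ((u * lam f * star u) (delta G))
      (restrict (F : Set G) (cosetDiag H u ((lam f * cosetDiag H (star u)) (delta G))))
    linarith
  refine (mem_vN_iff_of_mem_vN_top hu).2 fun g hg => ?_
  exact apply_eq_zero_of_norm_le_norm_restrict (le_of_forall_pos_le_add key) (A := (H : Set G)) hg

/-- The normalizer lies between the generators `lam '' H` and `L(H)`, both of which have double
commutant `L(H)`. -/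
theorem centralizer_centralizer_normalizer {F H : Subgroup G} (hFH : F ≤ H)
    (hP : ∀ S : Finset G, (∀ g ∈ S, g ∉ H) → ∃ f ∈ F, ∀ g ∈ S, ∀ h ∈ S, g * f * h ∉ F)
    (hN : (F.subgroupOf H).Normal) :
    Set.centralizer (Set.centralizer (normalizer (vN (⊤ : Subgroup G)) (vN F))) =
      (vN H : Set (L2 G →L[ℂ] L2 G)) := by
  refine Set.Subset.antisymm ?_ ?_
  · rw [← (vN H).centralizer_centralizer]
    exact Set.centralizer_subset (Set.centralizer_subset (normalizer_subset_vN hFH hP))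
  · rw [← centralizer_centralizer_lam]
    refine Set.centralizer_subset (Set.centralizer_subset ?_)
    rintro _ ⟨h, hh, rfl⟩
    exact lam_mem_normalizer hFH hN hh

end Expectation

end GroupWAHP

end

theorem mainTheorem10 {G : Type*} [Group G] (F H : Subgroup G) (hFH : F ≤ H)
    (hP : ∀ S : Finset G, (∀ g ∈ S, g ∉ H) →
      ∃ f ∈ F, ∀ g ∈ S, ∀ h ∈ S, g * f * h ∉ F) :
    GroupWAHP.RelativeWAHP (GroupWAHP.vN F) (GroupWAHP.vN H) (GroupWAHP.vN (⊤ : Subgroup G))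
        (GroupWAHP.trace G) ∧
      ((F.subgroupOf H).Normal →
        Set.centralizer (Set.centralizer
            (GroupWAHP.normalizer (GroupWAHP.vN (⊤ : Subgroup G)) (GroupWAHP.vN F))) =
          (GroupWAHP.vN H : Set (GroupWAHP.L2 G →L[ℂ] GroupWAHP.L2 G))) :=
  ⟨GroupWAHP.relativeWAHP_vN hFH hP, GroupWAHP.centralizer_centralizer_normalizer hFH hP⟩
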